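/- **Theorem (approximation error bound of TenExp).** Let $\mathcal X\in\mathbb R^{I_1\times I_2\times I_3}$ with $\|\mathcal X\|_F\le K$ for some constant $K$. Let $\mathbf X_{\langle n\rangle}$ be its mode-$n$ unfolding ($n=1,2,3$), $\sigma_1(\mathbf M)\ge\sigma_2(\mathbf M)\ge\cdots$ the singular values of a matrix $\mathbf M$, and $$\tau_r(\mathbf M)=\sum_{i=r+1}^{\operatorname{rank}\mathbf M}\sigma_i^2(\mathbf M)$$ (an empty sum is $0$). Let $R_n\le\operatorname{rank}\mathbf X_{\langle n\rangle}$ for $n=1,2,3$, $R_{n_1,n_2}\le\min(\operatorname{rank}\mathbf X_{\langle n_1\rangle},\operatorname{rank}\mathbf X_{\langle n_2\rangle})$ for $1\le n_1<n_2\le 3$, $\ell\le\operatorname{rank}\mathbf X_{\langle 3\rangle}$ and $R$ be natural numbers. For $n_1<n_2$ let $\mathbf X_{\langle n_1n_2\rangle}$ be the one of $\mathbf X_{\langle n_1\rangle},\mathbf X_{\langle n_2\rangle}$ with the smaller rank (either one if the ranks are equal). There is a matrix $\mathbf L\in\mathbb R^{I_3\times\ell}$ with orthonormal columns whose $j$-th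 column is, for $j=1,\dots,\ell$, a left singular vector of $\mathbf X_{\langle 3\rangle}$ for $\sigma_j(\mathbf X_{\langle 3\rangle})$. For every such $\mathbf L$ there are * a Tucker decomposition $\mathcal E_1=\mathcal C\times_1\mathbf H_1\times_2\mathbf H_2\times_3\mathbf H_3$ with core $\mathcal C\in\mathbb R^{R_1\times R_2\times R_3}$ and factor matrices $\mathbf H_n\in\mathbb R^{I_n\times R_n}$ that have orthonormal columns, * a fully-connected tensor network (FCTN) decomposition $\mathcal E_2(i,j,k)=\sum_{a,b,c}\mathcal G_1(i,a,b)\,\mathcal G_2(a,j,c)\,\mathcal G_3(b,c,k)$ with $\mathcal G_1\in\mathbb R^{I_1\times R_{1,2}\times R_{1,3}}$, $\mathcal G_2\in\mathbb R^{R_{1,2}\times I_2\times R_{2,3}}$, $\mathcal G_3\in\mathbb R^{R_{1,3}\times R_{2,3}\times I_3}$, * a t-product-induced factorization (TF) $\mathcal E_3=(\mathcal A\,\triangle\,\mathcal B)\times_3\mathbf L$ with $\mathcal A\in\mathbb R^{I_1\times R\times\ell}$, $\mathcal B\in\mathbb R^{R\times I_2\times\ell}$, where $\triangle$ multiplies corresponding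 frontal slices, such that for all gating values $\lambda_1,\lambda_2,\lambda_3\ge0$ with $\lambda_1+\lambda_2+\lambda_3=1$ the mixture $\hat{\mathcal X}=\lambda_1\mathcal E_1+\lambda_2\mathcal E_2+\lambda_3\mathcal E_3$ satisfies $$\|\mathcal X-\hat{\mathcal X}\|_F^2\le\lambda_1\sum_{n=1}^3\tau_{R_n}(\mathbf X_{\langle n\rangle})+\lambda_2\sum_{1\le n_1<n_2\le3}\tau_{R_{n_1,n_2}}(\mathbf X_{\langle n_1n_2\rangle})+\lambda_3\Bigl(\sum_{n=1}^{\ell}\tau_R\bigl((\mathcal X\times_3\mathbf L^{\top})^{(n)}\bigr)+\tau_\ell(\mathbf X_{\langle 3\rangle})\Bigr),$$ where $(\cdot)^{(n)}$ denotes the $n$-th frontal slice. -/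

import Mathlib

open scoped Matrix

noncomputable section

namespace TenExp

/-- Real third-order tensors of size `I₁ × I₂ × I₃`, given by their entries. -/
abbrev Tensor3 (I₁ I₂ I₃ : ℕ) : Type := Fin I₁ → Fin I₂ → Fin I₃ → ℝ

/-- The Frobenius norm of a third-order tensor. -/
def frobNorm {I₁ I₂ I₃ : ℕ} (X : Tensor3 I₁ I₂ I₃) : ℝ :=
  Real.sqrt (∑ i, ∑ j, ∑ k, (X i j k) ^ 2)

/-- The mode-1 unfolding; its columns are indexed by the pairs `(i₂, i₃)`. -/
def unfold₁ {I₁ I₂ I₃ : ℕ} (X : Tensor3 I₁ I₂ I₃) : Matrix (Fin I₁) (Fin I₂ × Fin I₃) ℝ :=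
  Matrix.of fun i p => X i p.1 p.2

/-- The mode-2 unfolding; its columns are indexed by the pairs `(i₁, i₃)`. -/
def unfold₂ {I₁ I₂ I₃ : ℕ} (X : Tensor3 I₁ I₂ I₃) : Matrix (Fin I₂) (Fin I₁ × Fin I₃) ℝ :=
  Matrix.of fun j p => X p.1 j p.2

/-- The mode-3 unfolding; its columns are indexed by the pairs `(i₁, i₂)`. -/
def unfold₃ {I₁ I₂ I₃ : ℕ} (X : Tensor3 I₁ I₂ I₃) : Matrix (Fin I₃) (Fin I₁ × Fin I₂) ℝ :=
  Matrix.of fun k p => X p.1 p.2 k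

/-- The `k`-th frontal slice. -/
def frontalSlice {I₁ I₂ I₃ : ℕ} (X : Tensor3 I₁ I₂ I₃) (k : Fin I₃) :
    Matrix (Fin I₁) (Fin I₂) ℝ :=
  Matrix.of fun i j => X i j k

/-- The singular values of a real matrix in decreasing order with multiplicity, numbered from `0`
and continued by zeros: `sv M i` is the `(i+1)`-st singular value. -/
def sv {m n : Type*} [Fintype m] [Fintype n] [DecidableEq n] (M : Matrix m n ℝ) (i : ℕ) : ℝ :=
  (Matrix.toEuclideanLin M).singularValues i

/-- The sum of the squares of the singular values of `M` discarded by a truncation to the `r`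
largest ones, `∑_{i = r+1}^{rank M} σ_i(M)²` (with `σ` numbered from `1`). -/
def tail {m n : Type*} [Fintype m] [Fintype n] [DecidableEq n] (M : Matrix m n ℝ) (r : ℕ) : ℝ :=
  ∑ i ∈ Finset.Ico r M.rank, sv M i ^ 2

/-- The rank of the unfolding in a mode; the modes 1, 2, 3 are the elements 0, 1, 2 of `Fin 3`. -/
def modeRank {I₁ I₂ I₃ : ℕ} (X : Tensor3 I₁ I₂ I₃) : Fin 3 → ℕ :=
  ![(unfold₁ X).rank, (unfold₂ X).rank, (unfold₃ X).rank]

/-- `modeTail X n r` is `tail` of the unfolding of `X` in the mode `n`. -/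
def modeTail {I₁ I₂ I₃ : ℕ} (X : Tensor3 I₁ I₂ I₃) (n : Fin 3) (r : ℕ) : ℝ :=
  ![tail (unfold₁ X) r, tail (unfold₂ X) r, tail (unfold₃ X) r] n

/-- `m` is that one of the modes `n₁`, `n₂` whose unfolding has the smaller rank
(either of them if the ranks agree). -/
def IsLowerRankMode {I₁ I₂ I₃ : ℕ} (X : Tensor3 I₁ I₂ I₃) (n₁ n₂ m : Fin 3) : Prop :=
  (m = n₁ ∨ m = n₂) ∧ modeRank X m = min (modeRank X n₁) (modeRank X n₂)

/-- The mode-1 product `X ×₁ A`. -/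
def modeProd₁ {I₁ I₂ I₃ J : ℕ} (X : Tensor3 I₁ I₂ I₃) (A : Matrix (Fin J) (Fin I₁) ℝ) :
    Tensor3 J I₂ I₃ :=
  fun a j k => ∑ i, X i j k * A a i

/-- The mode-2 product `X ×₂ A`. -/
def modeProd₂ {I₁ I₂ I₃ J : ℕ} (X : Tensor3 I₁ I₂ I₃) (A : Matrix (Fin J) (Fin I₂) ℝ) :
    Tensor3 I₁ J I₃ :=
  fun i a k => ∑ j, X i j k * A a j

/-- The mode-3 product `X ×₃ A`. -/
def modeProd₃ {I₁ I₂ I₃ J : ℕ} (X : Tensor3 I₁ I₂ I₃) (A : Matrix (Fin J) (Fin I₃) ℝ) :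
    Tensor3 I₁ I₂ J :=
  fun i j a => ∑ k, X i j k * A a k

/-- The face-wise product: the frontal slices are multiplied as matrices. -/
def faceProd {I₁ R I₂ l : ℕ} (A : Tensor3 I₁ R l) (B : Tensor3 R I₂ l) : Tensor3 I₁ I₂ l :=
  fun i j k => (frontalSlice A k * frontalSlice B k) i j

/-- The Tucker decomposition `C ×₁ H₁ ×₂ H₂ ×₃ H₃`. -/
def tucker {I₁ I₂ I₃ R₁ R₂ R₃ : ℕ} (C : Tensor3 R₁ R₂ R₃) (H₁ : Matrix (Fin I₁) (Fin R₁) ℝ)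
    (H₂ : Matrix (Fin I₂) (Fin R₂) ℝ) (H₃ : Matrix (Fin I₃) (Fin R₃) ℝ) : Tensor3 I₁ I₂ I₃ :=
  modeProd₃ (modeProd₂ (modeProd₁ C H₁) H₂) H₃

/-- The fully-connected tensor network decomposition of order three: every two of the three
factors are contracted along their common mode. -/
def fctn {I₁ I₂ I₃ R₁₂ R₁₃ R₂₃ : ℕ} (G₁ : Tensor3 I₁ R₁₂ R₁₃) (G₂ : Tensor3 R₁₂ I₂ R₂₃)
    (G₃ : Tensor3 R₁₃ R₂₃ I₃) : Tensor3 I₁ I₂ I₃ :=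
  fun i j k => ∑ a, ∑ b, ∑ c, G₁ i a b * G₂ a j c * G₃ b c k

/-- The t-product-induced factorization `(A △ B) ×₃ L` with a linear transform `L`. -/
def tf {I₁ I₂ I₃ R l : ℕ} (A : Tensor3 I₁ R l) (B : Tensor3 R I₂ l)
    (L : Matrix (Fin I₃) (Fin l) ℝ) : Tensor3 I₁ I₂ I₃ :=
  modeProd₃ (faceProd A B) L

/-- `H` has orthonormal columns. -/
def IsSemiOrthogonal {m r : ℕ} (H : Matrix (Fin m) (Fin r) ℝ) : Prop :=
  Hᵀ * H = 1

/-- The columns of `L` are, in this order, left singular vectors of `M` for its `l` largest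
singular values: `L` consists of the first `l` columns of the left factor of an SVD of `M`. -/
def IsLeadingLeftSingular {m l : ℕ} {n : Type*} [Fintype n] [DecidableEq n]
    (M : Matrix (Fin m) n ℝ) (L : Matrix (Fin m) (Fin l) ℝ) : Prop :=
  IsSemiOrthogonal L ∧
    ∀ j : Fin l, (M * Mᵀ) *ᵥ (fun i => L i j) = (sv M j) ^ 2 • (fun i => L i j)

/-- The mixture `λ₁ E₁ + λ₂ E₂ + λ₃ E₃`. -/
def mixture {I₁ I₂ I₃ : ℕ} (lam : Fin 3 → ℝ) (E₁ E₂ E₃ : Tensor3 I₁ I₂ I₃) :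
    Tensor3 I₁ I₂ I₃ :=
  lam 0 • E₁ + lam 1 • E₂ + lam 2 • E₃

end TenExp

end

/-! Squaring is convex, so the squared error of the mixture is at most the weighted mean of the
three squared errors (`tensorSq_sub_mixture_le`), and each decomposition can be bounded separately.
All three bounds rest on one fact: for orthonormal columns `H`, the residual `M - H * (Hᵀ * M)` is
orthogonal to the column space of `H`. When `H` holds leading left singular vectors of an unfolding,
that residual has squared norm `tail`, and projecting any approximation of `X` adds at most this
tail to its error.

Tucker: project in all three modes and add the tails. FCTN: a Tucker form truncated in only two
modes is an FCTN with one trivial bond; `exists_fctn_error_le` selects the mode left untruncated.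
TF: project in mode 3 by `L`, then approximate each frontal slice by a truncated SVD; here
Pythagoras gives the two errors exactly additively. -/

namespace TenExp

/-! ### Frobenius norm of matrices -/

section Matrices

variable {m n : Type*} [Fintype m] [Fintype n]

/-- The squared Frobenius norm of a matrix. -/
def frobSq (M : Matrix m n ℝ) : ℝ := ∑ i, ∑ j, M i j ^ 2

lemma frobSq_nonneg (M : Matrix m n ℝ) : 0 ≤ frobSq M :=
  Finset.sum_nonneg fun _ _ => Finset.sum_nonneg fun _ _ => sq_nonneg _

lemma frobSq_eq_trace (M : Matrix m n ℝ) : frobSq M = (Mᵀ * M).trace := by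
  simp only [frobSq, Matrix.trace, Matrix.diag_apply, Matrix.mul_apply, Matrix.transpose_apply]
  rw [Finset.sum_comm]
  simp [sq]

lemma frobSq_transpose (M : Matrix m n ℝ) : frobSq Mᵀ = frobSq M := by
  simp only [frobSq, Matrix.transpose_apply]
  exact Finset.sum_comm

/-- Pythagoras for the Frobenius norm. -/
lemma frobSq_add_of_transpose_mul_eq_zero {A B : Matrix m n ℝ} (h : Aᵀ * B = 0) :
    frobSq (A + B) = frobSq A + frobSq B := by
  have h' : Bᵀ * A = 0 := by simpa using congrArg Matrix.transpose h
  simp only [frobSq_eq_trace, Matrix.transpose_add, Matrix.add_mul, Matrix.mul_add, h, h',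
    Matrix.trace_add, Matrix.trace_zero]
  ring

end Matrices

/-! ### Projection onto orthonormal columns -/

section SemiOrthogonal

variable {m r : ℕ} {n : Type*} [Fintype n]

lemma IsSemiOrthogonal.frobSq_mul {H : Matrix (Fin m) (Fin r) ℝ} (hH : IsSemiOrthogonal H)
    (N : Matrix (Fin r) n ℝ) : frobSq (H * N) = frobSq N := by
  rw [frobSq_eq_trace, frobSq_eq_trace, Matrix.transpose_mul, Matrix.mul_assoc,
    ← Matrix.mul_assoc Hᵀ, hH, Matrix.one_mul]

/-- Pythagoras: `M - H * (Hᵀ * M)` is orthogonal to the columns of `H`, and `H` is an isometry on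
the remaining part `H * (Hᵀ * M - N)`. -/
lemma IsSemiOrthogonal.frobSq_sub_mul {H : Matrix (Fin m) (Fin r) ℝ} (hH : IsSemiOrthogonal H)
    (M : Matrix (Fin m) n ℝ) (N : Matrix (Fin r) n ℝ) :
    frobSq (M - H * N) = frobSq (M - H * (Hᵀ * M)) + frobSq (Hᵀ * M - N) := by
  rw [← hH.frobSq_mul (Hᵀ * M - N), ← frobSq_add_of_transpose_mul_eq_zero]
  · rw [Matrix.mul_sub]; congr 1; abel
  · have h : (M - H * (Hᵀ * M))ᵀ * H = 0 := by
      rw [← Matrix.transpose_transpose H, ← Matrix.transpose_mul, Matrix.transpose_transpose,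
        Matrix.mul_sub, ← Matrix.mul_assoc Hᵀ H, hH, Matrix.one_mul, sub_self,
        Matrix.transpose_zero]
    rw [← Matrix.mul_assoc, h, Matrix.zero_mul]

lemma IsSemiOrthogonal.frobSq_eq {H : Matrix (Fin m) (Fin r) ℝ} (hH : IsSemiOrthogonal H)
    (M : Matrix (Fin m) n ℝ) :
    frobSq M = frobSq (M - H * (Hᵀ * M)) + frobSq (Hᵀ * M) := by
  simpa using hH.frobSq_sub_mul M 0

lemma IsSemiOrthogonal.frobSq_transpose_mul_le {H : Matrix (Fin m) (Fin r) ℝ}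
    (hH : IsSemiOrthogonal H) (M : Matrix (Fin m) n ℝ) : frobSq (Hᵀ * M) ≤ frobSq M := by
  have := hH.frobSq_eq M
  have := frobSq_nonneg (M - H * (Hᵀ * M))
  linarith

/-- Projecting an approximation `N` of `M` onto the column space of `H` costs at most the
projection error of `M` itself. -/
lemma IsSemiOrthogonal.frobSq_sub_proj_le {H : Matrix (Fin m) (Fin r) ℝ}
    (hH : IsSemiOrthogonal H) (M N : Matrix (Fin m) n ℝ) :
    frobSq (M - H * (Hᵀ * N)) ≤ frobSq (M - H * (Hᵀ * M)) + frobSq (M - N) := by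
  rw [hH.frobSq_sub_mul M (Hᵀ * N), ← Matrix.mul_sub]
  gcongr
  exact hH.frobSq_transpose_mul_le _

end SemiOrthogonal

/-! ### Singular values, rank and tails -/

section SingularValues

variable {m n : Type*} [Fintype m] [Fintype n] [DecidableEq n]

lemma rank_eq_finrank_range_toEuclideanLin (M : Matrix m n ℝ) :
    M.rank = Module.finrank ℝ (LinearMap.range (Matrix.toEuclideanLin M)) := by
  rw [Matrix.toEuclideanLin, Matrix.toLpLin_eq_toLin]
  exact M.rank_eq_finrank_range_toLin _ _

lemma sv_pos {M : Matrix m n ℝ} {i : ℕ} (hi : i < M.rank) : 0 < sv M i := by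
  rw [sv, LinearMap.singularValues_pos_iff_lt_finrank_range,
    ← rank_eq_finrank_range_toEuclideanLin]
  exact hi

lemma adjoint_comp_toEuclideanLin [DecidableEq m] (M : Matrix m n ℝ) :
    LinearMap.adjoint (Matrix.toEuclideanLin M) ∘ₗ Matrix.toEuclideanLin M
      = Matrix.toEuclideanLin (Mᵀ * M) := by
  rw [← Matrix.toEuclideanLin_conjTranspose_eq_adjoint]
  ext x i
  simp [Matrix.conjTranspose_eq_transpose_of_trivial]

/-- Orthonormal right singular vectors of a real matrix. -/
lemma exists_right_singular_vectors (M : Matrix m n ℝ) :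
    ∃ v : Fin (Fintype.card n) → n → ℝ, (∀ i j, v i ⬝ᵥ v j = if i = j then 1 else 0) ∧
      ∀ i, (Mᵀ * M) *ᵥ v i = sv M i ^ 2 • v i := by
  classical
  set T := Matrix.toEuclideanLin M with hT
  have hn : Module.finrank ℝ (EuclideanSpace ℝ n) = Fintype.card n := finrank_euclideanSpace
  set b := T.isSymmetric_adjoint_comp_self.eigenvectorBasis hn with hb
  refine ⟨fun i => (b i).ofLp, fun i j => ?_, fun i => ?_⟩
  · rw [dotProduct_comm, ← orthonormal_iff_ite.mp b.orthonormal i j,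
      EuclideanSpace.inner_eq_star_dotProduct]
    simp
  · have h := T.isSymmetric_adjoint_comp_self.apply_eigenvectorBasis hn i
    rw [← T.sq_singularValues_fin hn, ← hb, hT, adjoint_comp_toEuclideanLin] at h
    simpa [sv] using congrArg WithLp.ofLp h

/-- Both sides are the trace of `Mᵀ * M`, whose eigenvalues are the squared singular values; those
from index `M.rank` on vanish. -/
lemma frobSq_eq_sum_sv (M : Matrix m n ℝ) :
    frobSq M = ∑ i ∈ Finset.range M.rank, sv M i ^ 2 := by
  classical
  set T := Matrix.toEuclideanLin M with hT
  have hn : Module.finrank ℝ (EuclideanSpace ℝ n) = Fintype.card n := finrank_euclideanSpace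
  have h1 : frobSq M = ∑ i ∈ Finset.range (Fintype.card n), sv M i ^ 2 := by
    have h := T.isSymmetric_adjoint_comp_self.trace_eq_sum_eigenvalues hn
    simp only [← T.sq_singularValues_fin hn] at h
    rw [hT, adjoint_comp_toEuclideanLin, Matrix.toEuclideanLin, Matrix.toLpLin_eq_toLin,
      Matrix.trace_toLin_eq] at h
    rw [Finset.sum_range, frobSq_eq_trace]
    simpa [sv] using h
  rw [h1]
  refine (Finset.sum_subset ?_ fun i _ hi => ?_).symm
  · exact Finset.range_subset_range.2 (by simpa using M.rank_le_card_width)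
  · rw [sv, (LinearMap.singularValues_eq_zero_iff_le_finrank_range _).2]
    · simp
    · rw [← rank_eq_finrank_range_toEuclideanLin]; simpa using hi

lemma tail_nonneg (M : Matrix m n ℝ) (r : ℕ) : 0 ≤ tail M r :=
  Finset.sum_nonneg fun _ _ => sq_nonneg _

/-- Used to compare bond dimensions in the cyclic cases of `exists_fctn_error_le`. -/
lemma tail_antitone (M : Matrix m n ℝ) : Antitone (tail M) := fun _ _ h =>
  Finset.sum_le_sum_of_subset_of_nonneg (Finset.Ico_subset_Ico_left h) fun _ _ _ => sq_nonneg _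

lemma tail_zero (M : Matrix m n ℝ) : tail M 0 = frobSq M := by
  rw [frobSq_eq_sum_sv, tail, Finset.range_eq_Ico]

end SingularValues

/-! ### Truncated singular value decomposition -/

section LeadingLeftSingular

variable {m l : ℕ} {n : Type*} [Fintype n] [DecidableEq n]

/-- The columns are `σ_j⁻¹ M v_j` for right singular vectors `v_j`; `l ≤ M.rank` makes every `σ_j`
used nonzero. -/
lemma exists_isLeadingLeftSingular (M : Matrix (Fin m) n ℝ) (hl : l ≤ M.rank) :
    ∃ L : Matrix (Fin m) (Fin l) ℝ, IsLeadingLeftSingular M L := by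
  obtain ⟨v, hv, hMv⟩ := exists_right_singular_vectors M
  let f : Fin l → Fin (Fintype.card n) := Fin.castLE (hl.trans M.rank_le_card_width)
  have hf : ∀ j, (f j : ℕ) = j := fun j => rfl
  have hpos : ∀ j : Fin l, sv M j ≠ 0 := fun j => (sv_pos (j.2.trans_le hl)).ne'
  refine ⟨Matrix.of fun i (j : Fin l) => (sv M j)⁻¹ * (M *ᵥ v (f j)) i, ?_, fun j => ?_⟩
  · ext j k
    have h1 : (M *ᵥ v (f j)) ⬝ᵥ (M *ᵥ v (f k)) = sv M k ^ 2 * if j = k then 1 else 0 := by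
      rw [Matrix.dotProduct_mulVec, Matrix.vecMul_mulVec, ← Matrix.dotProduct_mulVec, hMv,
        dotProduct_smul, hv, hf, smul_eq_mul]
      simp [f]
    have h2 : ((Matrix.of fun i (j : Fin l) => (sv M j)⁻¹ * (M *ᵥ v (f j)) i)ᵀ *
        (Matrix.of fun i (j : Fin l) => (sv M j)⁻¹ * (M *ᵥ v (f j)) i)) j k
        = (sv M j)⁻¹ * (sv M k)⁻¹ * ((M *ᵥ v (f j)) ⬝ᵥ (M *ᵥ v (f k))) := by
      simp only [Matrix.mul_apply, Matrix.transpose_apply, Matrix.of_apply, dotProduct,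
        Finset.mul_sum]
      exact Finset.sum_congr rfl fun _ _ => by ring
    rw [h2, h1, Matrix.one_apply]
    split_ifs with h
    · subst h
      have := hpos j
      field_simp
    · simp
  · have h : (fun i => (Matrix.of fun i (j : Fin l) => (sv M j)⁻¹ * (M *ᵥ v (f j)) i) i j)
        = (sv M j)⁻¹ • (M *ᵥ v (f j)) := rfl
    rw [h, Matrix.mulVec_smul, Matrix.mulVec_mulVec, Matrix.mul_assoc, ← Matrix.mulVec_mulVec,
      hMv, hf, Matrix.mulVec_smul, smul_comm]

lemma IsLeadingLeftSingular.frobSq_transpose_mul {M : Matrix (Fin m) n ℝ}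
    {L : Matrix (Fin m) (Fin l) ℝ} (hL : IsLeadingLeftSingular M L) :
    frobSq (Lᵀ * M) = ∑ j ∈ Finset.range l, sv M j ^ 2 := by
  have key : M * Mᵀ * L = L * Matrix.diagonal fun j : Fin l => sv M j ^ 2 := by
    ext i j
    rw [Matrix.mul_diagonal, mul_comm]
    exact congrFun (hL.2 j) i
  rw [← frobSq_transpose, frobSq_eq_trace, Matrix.transpose_transpose, Matrix.transpose_mul,
    Matrix.transpose_transpose, Matrix.mul_assoc, ← Matrix.mul_assoc M, key, ← Matrix.mul_assoc,
    hL.1, Matrix.one_mul, Matrix.trace_diagonal, Finset.sum_range]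

/-- The error of the truncated singular value decomposition. -/
lemma IsLeadingLeftSingular.frobSq_sub {M : Matrix (Fin m) n ℝ}
    {L : Matrix (Fin m) (Fin l) ℝ} (hL : IsLeadingLeftSingular M L) (hl : l ≤ M.rank) :
    frobSq (M - L * (Lᵀ * M)) = tail M l := by
  have h1 := hL.1.frobSq_eq M
  rw [hL.frobSq_transpose_mul, frobSq_eq_sum_sv] at h1
  have h2 := Finset.sum_range_add_sum_Ico (fun i => sv M i ^ 2) hl
  rw [tail]
  linarith

/-- Approximation of a matrix by a product of inner dimension `r`, which may exceed the rank. -/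
lemma exists_frobSq_sub_mul_le (M : Matrix (Fin m) n ℝ) (r : ℕ) :
    ∃ (A : Matrix (Fin m) (Fin r) ℝ) (B : Matrix (Fin r) n ℝ),
      frobSq (M - A * B) ≤ tail M r := by
  obtain h | h := le_total r M.rank
  · obtain ⟨L, hL⟩ := exists_isLeadingLeftSingular M h
    exact ⟨L, Lᵀ * M, (hL.frobSq_sub h).le⟩
  -- Truncation at the rank is exact; the `k` surplus inner indices are filled with zeros.
  · obtain ⟨L, hL⟩ := exists_isLeadingLeftSingular M le_rfl
    obtain ⟨k, rfl⟩ := Nat.exists_eq_add_of_le h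
    refine ⟨Matrix.of fun i => Fin.append (L i) 0, Matrix.of (Fin.append (Lᵀ * M) 0), ?_⟩
    have h2 : (Matrix.of fun i => Fin.append (L i) (0 : Fin k → ℝ)) *
        Matrix.of (Fin.append (Lᵀ * M) (0 : Fin k → n → ℝ)) = L * (Lᵀ * M) := by
      ext i j
      rw [Matrix.mul_apply, Matrix.mul_apply, Fin.sum_univ_add]
      have h3 (a : Fin M.rank) : Fin.append (Lᵀ * M) (0 : Fin k → n → ℝ) (Fin.castAdd k a)
          = (Lᵀ * M) a := Fin.append_left _ _ _
      simp [h3]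
    rw [h2, hL.frobSq_sub le_rfl]
    simp [tail]

end LeadingLeftSingular

/-! ### Unfoldings, mode products and truncation in one mode -/

section Tensors

variable {I₁ I₂ I₃ : ℕ}

/-- The squared Frobenius norm of a third-order tensor. -/
def tensorSq (X : Tensor3 I₁ I₂ I₃) : ℝ := ∑ i, ∑ j, ∑ k, X i j k ^ 2

lemma tensorSq_nonneg (X : Tensor3 I₁ I₂ I₃) : 0 ≤ tensorSq X :=
  Finset.sum_nonneg fun _ _ => Finset.sum_nonneg fun _ _ => Finset.sum_nonneg fun _ _ =>
    sq_nonneg _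

lemma frobNorm_sq (X : Tensor3 I₁ I₂ I₃) : frobNorm X ^ 2 = tensorSq X :=
  Real.sq_sqrt (tensorSq_nonneg X)

lemma frobSq_unfold₁ (X : Tensor3 I₁ I₂ I₃) : frobSq (unfold₁ X) = tensorSq X := by
  simp only [frobSq, unfold₁, tensorSq, Fintype.sum_prod_type, Matrix.of_apply]

lemma frobSq_unfold₂ (X : Tensor3 I₁ I₂ I₃) : frobSq (unfold₂ X) = tensorSq X := by
  simp only [frobSq, unfold₂, tensorSq, Fintype.sum_prod_type, Matrix.of_apply]
  exact Finset.sum_comm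

lemma frobSq_unfold₃ (X : Tensor3 I₁ I₂ I₃) : frobSq (unfold₃ X) = tensorSq X := by
  simp only [frobSq, unfold₃, tensorSq, Fintype.sum_prod_type, Matrix.of_apply]
  rw [Finset.sum_comm]
  exact Finset.sum_congr rfl fun _ _ => Finset.sum_comm

lemma sum_frobSq_frontalSlice (X : Tensor3 I₁ I₂ I₃) :
    ∑ k, frobSq (frontalSlice X k) = tensorSq X := by
  rw [← frobSq_unfold₃]
  simp only [frobSq, unfold₃, frontalSlice, Fintype.sum_prod_type, Matrix.of_apply]

lemma unfold₁_modeProd₁ {J : ℕ} (X : Tensor3 I₁ I₂ I₃) (A : Matrix (Fin J) (Fin I₁) ℝ) :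
    unfold₁ (modeProd₁ X A) = A * unfold₁ X := by
  ext a p
  simp only [unfold₁, modeProd₁, Matrix.of_apply, Matrix.mul_apply, mul_comm]

lemma unfold₂_modeProd₂ {J : ℕ} (X : Tensor3 I₁ I₂ I₃) (A : Matrix (Fin J) (Fin I₂) ℝ) :
    unfold₂ (modeProd₂ X A) = A * unfold₂ X := by
  ext a p
  simp only [unfold₂, modeProd₂, Matrix.of_apply, Matrix.mul_apply, mul_comm]

lemma unfold₃_modeProd₃ {J : ℕ} (X : Tensor3 I₁ I₂ I₃) (A : Matrix (Fin J) (Fin I₃) ℝ) :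
    unfold₃ (modeProd₃ X A) = A * unfold₃ X := by
  ext a p
  simp only [unfold₃, modeProd₃, Matrix.of_apply, Matrix.mul_apply, mul_comm]

lemma modeProd₁_modeProd₂ {J₁ J₂ : ℕ} (X : Tensor3 I₁ I₂ I₃) (A : Matrix (Fin J₁) (Fin I₁) ℝ)
    (B : Matrix (Fin J₂) (Fin I₂) ℝ) :
    modeProd₁ (modeProd₂ X B) A = modeProd₂ (modeProd₁ X A) B := by
  funext i j k
  simp only [modeProd₁, modeProd₂, Finset.sum_mul, mul_right_comm]
  exact Finset.sum_comm

lemma modeProd₁_modeProd₃ {J₁ J₃ : ℕ} (X : Tensor3 I₁ I₂ I₃) (A : Matrix (Fin J₁) (Fin I₁) ℝ)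
    (B : Matrix (Fin J₃) (Fin I₃) ℝ) :
    modeProd₁ (modeProd₃ X B) A = modeProd₃ (modeProd₁ X A) B := by
  funext i j k
  simp only [modeProd₁, modeProd₃, Finset.sum_mul, mul_right_comm]
  exact Finset.sum_comm

lemma modeProd₂_modeProd₃ {J₂ J₃ : ℕ} (X : Tensor3 I₁ I₂ I₃) (A : Matrix (Fin J₂) (Fin I₂) ℝ)
    (B : Matrix (Fin J₃) (Fin I₃) ℝ) :
    modeProd₂ (modeProd₃ X B) A = modeProd₃ (modeProd₂ X A) B := by
  funext i j k
  simp only [modeProd₂, modeProd₃, Finset.sum_mul, mul_right_comm]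
  exact Finset.sum_comm

/-- Truncation in mode 1: projecting an approximation `Y` of `X` adds at most the tail of the
mode-1 unfolding to the squared error. -/
lemma exists_truncation₁ (X : Tensor3 I₁ I₂ I₃) {r : ℕ} (hr : r ≤ (unfold₁ X).rank) :
    ∃ H : Matrix (Fin I₁) (Fin r) ℝ, IsSemiOrthogonal H ∧ ∀ Y : Tensor3 I₁ I₂ I₃,
      tensorSq (X - modeProd₁ (modeProd₁ Y Hᵀ) H) ≤ tail (unfold₁ X) r + tensorSq (X - Y) := by
  obtain ⟨H, hH⟩ := exists_isLeadingLeftSingular (unfold₁ X) hr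
  refine ⟨H, hH.1, fun Y => ?_⟩
  have h := hH.1.frobSq_sub_proj_le (unfold₁ X) (unfold₁ Y)
  rw [hH.frobSq_sub hr, ← unfold₁_modeProd₁, ← unfold₁_modeProd₁] at h
  rw [← frobSq_unfold₁, ← frobSq_unfold₁]
  exact h

/-- Truncation in mode 2: projecting an approximation `Y` of `X` adds at most the tail of the
mode-2 unfolding to the squared error. -/
lemma exists_truncation₂ (X : Tensor3 I₁ I₂ I₃) {r : ℕ} (hr : r ≤ (unfold₂ X).rank) :
    ∃ H : Matrix (Fin I₂) (Fin r) ℝ, IsSemiOrthogonal H ∧ ∀ Y : Tensor3 I₁ I₂ I₃,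
      tensorSq (X - modeProd₂ (modeProd₂ Y Hᵀ) H) ≤ tail (unfold₂ X) r + tensorSq (X - Y) := by
  obtain ⟨H, hH⟩ := exists_isLeadingLeftSingular (unfold₂ X) hr
  refine ⟨H, hH.1, fun Y => ?_⟩
  have h := hH.1.frobSq_sub_proj_le (unfold₂ X) (unfold₂ Y)
  rw [hH.frobSq_sub hr, ← unfold₂_modeProd₂, ← unfold₂_modeProd₂] at h
  rw [← frobSq_unfold₂, ← frobSq_unfold₂]
  exact h

/-- Truncation in mode 3: projecting an approximation `Y` of `X` adds at most the tail of the
mode-3 unfolding to the squared error. -/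
lemma exists_truncation₃ (X : Tensor3 I₁ I₂ I₃) {r : ℕ} (hr : r ≤ (unfold₃ X).rank) :
    ∃ H : Matrix (Fin I₃) (Fin r) ℝ, IsSemiOrthogonal H ∧ ∀ Y : Tensor3 I₁ I₂ I₃,
      tensorSq (X - modeProd₃ (modeProd₃ Y Hᵀ) H) ≤ tail (unfold₃ X) r + tensorSq (X - Y) := by
  obtain ⟨H, hH⟩ := exists_isLeadingLeftSingular (unfold₃ X) hr
  refine ⟨H, hH.1, fun Y => ?_⟩
  have h := hH.1.frobSq_sub_proj_le (unfold₃ X) (unfold₃ Y)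
  rw [hH.frobSq_sub hr, ← unfold₃_modeProd₃, ← unfold₃_modeProd₃] at h
  rw [← frobSq_unfold₃, ← frobSq_unfold₃]
  exact h

lemma tensorSq_sub_self (X : Tensor3 I₁ I₂ I₃) : tensorSq (X - X) = 0 := by
  simp [tensorSq]

/-! ### Tucker decomposition -/

/-- The error bound of the truncated higher-order singular value decomposition. -/
lemma exists_tucker_error_le (X : Tensor3 I₁ I₂ I₃) {R₁ R₂ R₃ : ℕ}
    (h₁ : R₁ ≤ (unfold₁ X).rank) (h₂ : R₂ ≤ (unfold₂ X).rank) (h₃ : R₃ ≤ (unfold₃ X).rank) :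
    ∃ (C : Tensor3 R₁ R₂ R₃) (H₁ : Matrix (Fin I₁) (Fin R₁) ℝ)
      (H₂ : Matrix (Fin I₂) (Fin R₂) ℝ) (H₃ : Matrix (Fin I₃) (Fin R₃) ℝ),
      IsSemiOrthogonal H₁ ∧ IsSemiOrthogonal H₂ ∧ IsSemiOrthogonal H₃ ∧
      tensorSq (X - tucker C H₁ H₂ H₃)
        ≤ tail (unfold₁ X) R₁ + tail (unfold₂ X) R₂ + tail (unfold₃ X) R₃ := by
  obtain ⟨H₁, o₁, e₁⟩ := exists_truncation₁ X h₁
  obtain ⟨H₂, o₂, e₂⟩ := exists_truncation₂ X h₂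
  obtain ⟨H₃, o₃, e₃⟩ := exists_truncation₃ X h₃
  refine ⟨modeProd₃ (modeProd₂ (modeProd₁ X H₁ᵀ) H₂ᵀ) H₃ᵀ, H₁, H₂, H₃, o₁, o₂, o₃, ?_⟩
  -- Products in different modes commute, which turns the Tucker form into three nested projections.
  -- Each truncation bound is then applied to the output of the previous one, starting from `X` with
  -- error zero.
  simp only [tucker, modeProd₁_modeProd₃, modeProd₁_modeProd₂, modeProd₂_modeProd₃]
  have t₁ := e₁ X
  have t₂ := e₂ (modeProd₁ (modeProd₁ X H₁ᵀ) H₁)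
  have t₃ := e₃ (modeProd₂ (modeProd₂ (modeProd₁ (modeProd₁ X H₁ᵀ) H₁) H₂ᵀ) H₂)
  rw [tensorSq_sub_self] at t₁
  linarith

/-! ### Fully-connected tensor network -/

/-- The core sits at mode 3 and is joined to `H₁` and `H₂` by its own bonds. The bond between modes
1 and 2 carries nothing: `G₁` is supported on its index 0, which must exist, hence `0 < R₁₂`. The
next two lemmas place the core at modes 2 and 1. -/
lemma exists_fctn_eq_modeProd₁₂ {R₁₂ R₁₃ R₂₃ : ℕ} (h : 0 < R₁₂) (C : Tensor3 R₁₃ R₂₃ I₃)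
    (H₁ : Matrix (Fin I₁) (Fin R₁₃) ℝ) (H₂ : Matrix (Fin I₂) (Fin R₂₃) ℝ) :
    ∃ (G₁ : Tensor3 I₁ R₁₂ R₁₃) (G₂ : Tensor3 R₁₂ I₂ R₂₃) (G₃ : Tensor3 R₁₃ R₂₃ I₃),
      fctn G₁ G₂ G₃ = modeProd₂ (modeProd₁ C H₁) H₂ := by
  refine ⟨fun i a b => if a = ⟨0, h⟩ then H₁ i b else 0,
    fun _ j c => H₂ j c, C, ?_⟩
  funext i j k
  simp only [fctn, modeProd₂, modeProd₁, ite_mul, zero_mul, Finset.sum_mul]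
  rw [Finset.sum_eq_single_of_mem ⟨0, h⟩ (Finset.mem_univ _) fun a _ ha => by simp [ha],
    Finset.sum_comm]
  simp only [if_true]
  exact Finset.sum_congr rfl fun _ _ => Finset.sum_congr rfl fun _ _ => by ring

lemma exists_fctn_eq_modeProd₁₃ {R₁₂ R₁₃ R₂₃ : ℕ} (h : 0 < R₁₃) (C : Tensor3 R₁₂ I₂ R₂₃)
    (H₁ : Matrix (Fin I₁) (Fin R₁₂) ℝ) (H₃ : Matrix (Fin I₃) (Fin R₂₃) ℝ) :
    ∃ (G₁ : Tensor3 I₁ R₁₂ R₁₃) (G₂ : Tensor3 R₁₂ I₂ R₂₃) (G₃ : Tensor3 R₁₃ R₂₃ I₃),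
      fctn G₁ G₂ G₃ = modeProd₃ (modeProd₁ C H₁) H₃ := by
  refine ⟨fun i a b => if b = ⟨0, h⟩ then H₁ i a else 0,
    C, fun _ c k => H₃ k c, ?_⟩
  funext i j k
  simp only [fctn, modeProd₃, modeProd₁, ite_mul, zero_mul, Finset.sum_mul]
  rw [Finset.sum_comm, Finset.sum_eq_single_of_mem ⟨0, h⟩ (Finset.mem_univ _)
    fun a _ ha => by simp [ha], Finset.sum_comm]
  simp only [if_true]
  exact Finset.sum_congr rfl fun _ _ => Finset.sum_congr rfl fun _ _ => by ring

lemma exists_fctn_eq_modeProd₂₃ {R₁₂ R₁₃ R₂₃ : ℕ} (h : 0 < R₂₃) (C : Tensor3 I₁ R₁₂ R₁₃)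
    (H₂ : Matrix (Fin I₂) (Fin R₁₂) ℝ) (H₃ : Matrix (Fin I₃) (Fin R₁₃) ℝ) :
    ∃ (G₁ : Tensor3 I₁ R₁₂ R₁₃) (G₂ : Tensor3 R₁₂ I₂ R₂₃) (G₃ : Tensor3 R₁₃ R₂₃ I₃),
      fctn G₁ G₂ G₃ = modeProd₃ (modeProd₂ C H₂) H₃ := by
  refine ⟨C, fun a j c => if c = ⟨0, h⟩ then H₂ j a else 0,
    fun b _ k => H₃ k b, ?_⟩
  funext i j k
  simp only [fctn, modeProd₃, modeProd₂, mul_ite, ite_mul, mul_zero, zero_mul, Finset.sum_mul,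
    Finset.sum_ite_eq', Finset.mem_univ, if_true]
  exact Finset.sum_comm

lemma exists_fctn_error_le₁₂ (X : Tensor3 I₁ I₂ I₃) {R₁₂ R₁₃ R₂₃ : ℕ} (h : 0 < R₁₂)
    (h₁ : R₁₃ ≤ (unfold₁ X).rank) (h₂ : R₂₃ ≤ (unfold₂ X).rank) :
    ∃ (G₁ : Tensor3 I₁ R₁₂ R₁₃) (G₂ : Tensor3 R₁₂ I₂ R₂₃) (G₃ : Tensor3 R₁₃ R₂₃ I₃),
      tensorSq (X - fctn G₁ G₂ G₃) ≤ tail (unfold₁ X) R₁₃ + tail (unfold₂ X) R₂₃ := by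
  obtain ⟨H₁, -, e₁⟩ := exists_truncation₁ X h₁
  obtain ⟨H₂, -, e₂⟩ := exists_truncation₂ X h₂
  obtain ⟨G₁, G₂, G₃, hG⟩ :=
    exists_fctn_eq_modeProd₁₂ h (modeProd₂ (modeProd₁ X H₁ᵀ) H₂ᵀ) H₁ H₂
  refine ⟨G₁, G₂, G₃, ?_⟩
  rw [hG, modeProd₁_modeProd₂]
  have t₁ := e₁ X
  have t₂ := e₂ (modeProd₁ (modeProd₁ X H₁ᵀ) H₁)
  rw [tensorSq_sub_self] at t₁
  linarith

lemma exists_fctn_error_le₁₃ (X : Tensor3 I₁ I₂ I₃) {R₁₂ R₁₃ R₂₃ : ℕ} (h : 0 < R₁₃)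
    (h₁ : R₁₂ ≤ (unfold₁ X).rank) (h₃ : R₂₃ ≤ (unfold₃ X).rank) :
    ∃ (G₁ : Tensor3 I₁ R₁₂ R₁₃) (G₂ : Tensor3 R₁₂ I₂ R₂₃) (G₃ : Tensor3 R₁₃ R₂₃ I₃),
      tensorSq (X - fctn G₁ G₂ G₃) ≤ tail (unfold₁ X) R₁₂ + tail (unfold₃ X) R₂₃ := by
  obtain ⟨H₁, -, e₁⟩ := exists_truncation₁ X h₁
  obtain ⟨H₃, -, e₃⟩ := exists_truncation₃ X h₃
  obtain ⟨G₁, G₂, G₃, hG⟩ :=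
    exists_fctn_eq_modeProd₁₃ h (modeProd₃ (modeProd₁ X H₁ᵀ) H₃ᵀ) H₁ H₃
  refine ⟨G₁, G₂, G₃, ?_⟩
  rw [hG, modeProd₁_modeProd₃]
  have t₁ := e₁ X
  have t₃ := e₃ (modeProd₁ (modeProd₁ X H₁ᵀ) H₁)
  rw [tensorSq_sub_self] at t₁
  linarith

lemma exists_fctn_error_le₂₃ (X : Tensor3 I₁ I₂ I₃) {R₁₂ R₁₃ R₂₃ : ℕ} (h : 0 < R₂₃)
    (h₂ : R₁₂ ≤ (unfold₂ X).rank) (h₃ : R₁₃ ≤ (unfold₃ X).rank) :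
    ∃ (G₁ : Tensor3 I₁ R₁₂ R₁₃) (G₂ : Tensor3 R₁₂ I₂ R₂₃) (G₃ : Tensor3 R₁₃ R₂₃ I₃),
      tensorSq (X - fctn G₁ G₂ G₃) ≤ tail (unfold₂ X) R₁₂ + tail (unfold₃ X) R₁₃ := by
  obtain ⟨H₂, -, e₂⟩ := exists_truncation₂ X h₂
  obtain ⟨H₃, -, e₃⟩ := exists_truncation₃ X h₃
  obtain ⟨G₁, G₂, G₃, hG⟩ :=
    exists_fctn_eq_modeProd₂₃ h (modeProd₃ (modeProd₂ X H₂ᵀ) H₃ᵀ) H₂ H₃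
  refine ⟨G₁, G₂, G₃, ?_⟩
  rw [hG, modeProd₂_modeProd₃]
  have t₂ := e₂ X
  have t₃ := e₃ (modeProd₂ (modeProd₂ X H₂ᵀ) H₂)
  rw [tensorSq_sub_self] at t₂
  linarith

lemma modeTail_nonneg (X : Tensor3 I₁ I₂ I₃) (n : Fin 3) (r : ℕ) : 0 ≤ modeTail X n r := by
  fin_cases n <;> exact tail_nonneg _ _

lemma modeTail_antitone (X : Tensor3 I₁ I₂ I₃) (n : Fin 3) : Antitone (modeTail X n) := by
  fin_cases n <;> exact tail_antitone _

lemma modeTail_zero (X : Tensor3 I₁ I₂ I₃) (n : Fin 3) : modeTail X n 0 = tensorSq X := by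
  fin_cases n
  · exact (tail_zero _).trans (frobSq_unfold₁ X)
  · exact (tail_zero _).trans (frobSq_unfold₂ X)
  · exact (tail_zero _).trans (frobSq_unfold₃ X)

/-- A choice of one mode from every pair of modes either leaves one mode out or is cyclic. In the
first case the core is placed at that mode; in the second, some core position works because the
three bond dimensions cannot decrease all the way around the cycle. -/
lemma exists_fctn_error_le (X : Tensor3 I₁ I₂ I₃) {R₁₂ R₁₃ R₂₃ : ℕ}
    (hR₁₂ : R₁₂ ≤ min (modeRank X 0) (modeRank X 1))
    (hR₁₃ : R₁₃ ≤ min (modeRank X 0) (modeRank X 2))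
    (hR₂₃ : R₂₃ ≤ min (modeRank X 1) (modeRank X 2)) {m₁₂ m₁₃ m₂₃ : Fin 3}
    (hm₁₂ : m₁₂ = 0 ∨ m₁₂ = 1) (hm₁₃ : m₁₃ = 0 ∨ m₁₃ = 2) (hm₂₃ : m₂₃ = 1 ∨ m₂₃ = 2) :
    ∃ (G₁ : Tensor3 I₁ R₁₂ R₁₃) (G₂ : Tensor3 R₁₂ I₂ R₂₃) (G₃ : Tensor3 R₁₃ R₂₃ I₃),
      tensorSq (X - fctn G₁ G₂ G₃)
        ≤ modeTail X m₁₂ R₁₂ + modeTail X m₁₃ R₁₃ + modeTail X m₂₃ R₂₃ := by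
  have n₁₂ := modeTail_nonneg X m₁₂ R₁₂
  have n₁₃ := modeTail_nonneg X m₁₃ R₁₃
  have n₂₃ := modeTail_nonneg X m₂₃ R₂₃
  by_cases h0 : R₁₂ = 0 ∨ R₁₃ = 0 ∨ R₂₃ = 0
  -- With an empty bond the zero network suffices: the tail at rank 0 is already the whole squared
  -- norm of `X`.
  · refine ⟨0, 0, 0, ?_⟩
    have hz : X - fctn (0 : Tensor3 I₁ R₁₂ R₁₃) (0 : Tensor3 R₁₂ I₂ R₂₃) 0 = X := by
      funext i j k
      simp [fctn]
    rw [hz]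
    rcases h0 with rfl | rfl | rfl <;> rw [modeTail_zero] at * <;> linarith
  have p₁₂ : 0 < R₁₂ := by omega
  have p₁₃ : 0 < R₁₃ := by omega
  have p₂₃ : 0 < R₂₃ := by omega
  obtain ⟨a₁₂, b₁₂⟩ := le_min_iff.1 hR₁₂
  obtain ⟨a₁₃, b₁₃⟩ := le_min_iff.1 hR₁₃
  obtain ⟨a₂₃, b₂₃⟩ := le_min_iff.1 hR₂₃
  have core₁ : ∃ (G₁ : Tensor3 I₁ R₁₂ R₁₃) (G₂ : Tensor3 R₁₂ I₂ R₂₃) (G₃ : Tensor3 R₁₃ R₂₃ I₃),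
      tensorSq (X - fctn G₁ G₂ G₃) ≤ modeTail X 1 R₁₂ + modeTail X 2 R₁₃ :=
    exists_fctn_error_le₂₃ X p₂₃ b₁₂ b₁₃
  have core₂ : ∃ (G₁ : Tensor3 I₁ R₁₂ R₁₃) (G₂ : Tensor3 R₁₂ I₂ R₂₃) (G₃ : Tensor3 R₁₃ R₂₃ I₃),
      tensorSq (X - fctn G₁ G₂ G₃) ≤ modeTail X 0 R₁₂ + modeTail X 2 R₂₃ :=
    exists_fctn_error_le₁₃ X p₁₃ a₁₂ b₂₃
  have core₃ : ∃ (G₁ : Tensor3 I₁ R₁₂ R₁₃) (G₂ : Tensor3 R₁₂ I₂ R₂₃) (G₃ : Tensor3 R₁₃ R₂₃ I₃),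
      tensorSq (X - fctn G₁ G₂ G₃) ≤ modeTail X 0 R₁₃ + modeTail X 1 R₂₃ :=
    exists_fctn_error_le₁₂ X p₁₂ a₁₃ a₂₃
  have weaken {s t : ℝ} (hst : s ≤ t)
      (h : ∃ (G₁ : Tensor3 I₁ R₁₂ R₁₃) (G₂ : Tensor3 R₁₂ I₂ R₂₃) (G₃ : Tensor3 R₁₃ R₂₃ I₃),
        tensorSq (X - fctn G₁ G₂ G₃) ≤ s) :
      ∃ (G₁ : Tensor3 I₁ R₁₂ R₁₃) (G₂ : Tensor3 R₁₂ I₂ R₂₃) (G₃ : Tensor3 R₁₃ R₂₃ I₃),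
        tensorSq (X - fctn G₁ G₂ G₃) ≤ t := by
    obtain ⟨G₁, G₂, G₃, h⟩ := h
    exact ⟨G₁, G₂, G₃, h.trans hst⟩
  rcases hm₁₂ with rfl | rfl <;> rcases hm₁₃ with rfl | rfl <;> rcases hm₂₃ with rfl | rfl
  · exact weaken (by linarith) core₃
  · exact weaken (by linarith) core₂
  -- If all three failed, then `R₁₂ > R₁₃ > R₂₃ > R₁₂`. Each inequality lets one tail be taken at a
  -- larger rank, and the unmatched third tail is dropped as nonnegative.
  · obtain h | h | h : R₁₂ ≤ R₁₃ ∨ R₂₃ ≤ R₁₂ ∨ R₁₃ ≤ R₂₃ := by omega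
    · exact weaken (by linarith [modeTail_antitone X 0 h]) core₃
    · exact weaken (by linarith [modeTail_antitone X 1 h]) core₁
    · exact weaken (by linarith [modeTail_antitone X 2 h]) core₂
  · exact weaken (by linarith) core₂
  · exact weaken (by linarith) core₃
  · obtain h | h | h : R₁₂ ≤ R₂₃ ∨ R₁₃ ≤ R₁₂ ∨ R₂₃ ≤ R₁₃ := by omega
    · exact weaken (by linarith [modeTail_antitone X 1 h]) core₃
    · exact weaken (by linarith [modeTail_antitone X 0 h]) core₂
    · exact weaken (by linarith [modeTail_antitone X 2 h]) core₁
  · exact weaken (by linarith) core₁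
  · exact weaken (by linarith) core₁

/-! ### t-product-induced factorization -/

lemma exists_tf_error_le (X : Tensor3 I₁ I₂ I₃) {l : ℕ} (R : ℕ) (hl : l ≤ (unfold₃ X).rank)
    {L : Matrix (Fin I₃) (Fin l) ℝ} (hL : IsLeadingLeftSingular (unfold₃ X) L) :
    ∃ (A : Tensor3 I₁ R l) (B : Tensor3 R I₂ l),
      tensorSq (X - tf A B L)
        ≤ (∑ n, tail (frontalSlice (modeProd₃ X Lᵀ) n) R) + tail (unfold₃ X) l := by
  choose A B hAB using fun n => exists_frobSq_sub_mul_le (frontalSlice (modeProd₃ X Lᵀ) n) R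
  refine ⟨fun i a n => A n i a, fun a j n => B n a j, ?_⟩
  set Y : Tensor3 I₁ I₂ l := faceProd (fun i a n => A n i a) (fun a j n => B n a j) with hY
  have hslice : tensorSq (modeProd₃ X Lᵀ - Y)
      ≤ ∑ n, tail (frontalSlice (modeProd₃ X Lᵀ) n) R := by
    rw [← sum_frobSq_frontalSlice]
    exact Finset.sum_le_sum fun n _ => hAB n
  -- Splits the error into the part outside the span of `L` and the slice errors in the transformed
  -- coordinates.
  have h := hL.1.frobSq_sub_mul (unfold₃ X) (unfold₃ Y)
  rw [hL.frobSq_sub hl, ← unfold₃_modeProd₃, ← unfold₃_modeProd₃] at h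
  have h1 : tensorSq (X - modeProd₃ Y L)
      = tail (unfold₃ X) l + tensorSq (modeProd₃ X Lᵀ - Y) := by
    rw [← frobSq_unfold₃, ← frobSq_unfold₃]
    exact h
  change tensorSq (X - modeProd₃ Y L) ≤ _
  linarith

/-! ### The mixture -/

/-- Convexity of the squared Frobenius norm. -/
lemma tensorSq_sub_mixture_le (X E₁ E₂ E₃ : Tensor3 I₁ I₂ I₃) {lam : Fin 3 → ℝ}
    (h0 : ∀ i, 0 ≤ lam i) (h1 : ∑ i, lam i = 1) :
    tensorSq (X - mixture lam E₁ E₂ E₃)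
      ≤ lam 0 * tensorSq (X - E₁) + lam 1 * tensorSq (X - E₂) + lam 2 * tensorSq (X - E₃) := by
  simp only [tensorSq, Finset.mul_sum, ← Finset.sum_add_distrib]
  refine Finset.sum_le_sum fun i _ => Finset.sum_le_sum fun j _ => Finset.sum_le_sum fun k _ => ?_
  -- Jensen for the square, entry by entry; since the weights sum to 1, the residual of the mixture
  -- is the weighted mean of the residuals.
  have hc := (even_two.convexOn_pow (𝕜 := ℝ)).map_sum_le (t := Finset.univ) (w := lam)
    (p := ![(X - E₁) i j k, (X - E₂) i j k, (X - E₃) i j k]) (fun i _ => h0 i) h1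
    (fun _ _ => Set.mem_univ _)
  simp only [Fin.sum_univ_three, smul_eq_mul] at hc h1
  refine le_trans (le_of_eq ?_) hc
  congr 1
  simp only [mixture, Pi.sub_apply, Pi.add_apply, Pi.smul_apply, smul_eq_mul, Matrix.cons_val]
  linear_combination -X i j k * h1

end Tensors

end TenExp

theorem mainTheorem1 {I₁ I₂ I₃ : ℕ} (X : TenExp.Tensor3 I₁ I₂ I₃)
    (K : ℝ) (hK : TenExp.frobNorm X ≤ K)
    -- the ranks of the three decompositions and the latent dimension
    (R₁ R₂ R₃ R₁₂ R₁₃ R₂₃ R l : ℕ)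
    (hR₁ : R₁ ≤ TenExp.modeRank X 0) (hR₂ : R₂ ≤ TenExp.modeRank X 1)
    (hR₃ : R₃ ≤ TenExp.modeRank X 2)
    (hR₁₂ : R₁₂ ≤ min (TenExp.modeRank X 0) (TenExp.modeRank X 1))
    (hR₁₃ : R₁₃ ≤ min (TenExp.modeRank X 0) (TenExp.modeRank X 2))
    (hR₂₃ : R₂₃ ≤ min (TenExp.modeRank X 1) (TenExp.modeRank X 2))
    (hl : l ≤ TenExp.modeRank X 2)
    -- in every pair of modes, the one whose unfolding has the smaller rank
    (m₁₂ m₁₃ m₂₃ : Fin 3)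
    (hm₁₂ : TenExp.IsLowerRankMode X 0 1 m₁₂)
    (hm₁₃ : TenExp.IsLowerRankMode X 0 2 m₁₃)
    (hm₂₃ : TenExp.IsLowerRankMode X 1 2 m₂₃) :
    (∃ L : Matrix (Fin I₃) (Fin l) ℝ,
      TenExp.IsLeadingLeftSingular (TenExp.unfold₃ X) L) ∧
    ∀ L : Matrix (Fin I₃) (Fin l) ℝ, TenExp.IsLeadingLeftSingular (TenExp.unfold₃ X) L →
      ∃ (C : TenExp.Tensor3 R₁ R₂ R₃) (H₁ : Matrix (Fin I₁) (Fin R₁) ℝ)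
        (H₂ : Matrix (Fin I₂) (Fin R₂) ℝ) (H₃ : Matrix (Fin I₃) (Fin R₃) ℝ)
        (G₁ : TenExp.Tensor3 I₁ R₁₂ R₁₃) (G₂ : TenExp.Tensor3 R₁₂ I₂ R₂₃)
        (G₃ : TenExp.Tensor3 R₁₃ R₂₃ I₃)
        (A : TenExp.Tensor3 I₁ R l) (B : TenExp.Tensor3 R I₂ l),
        TenExp.IsSemiOrthogonal H₁ ∧ TenExp.IsSemiOrthogonal H₂ ∧ TenExp.IsSemiOrthogonal H₃ ∧
        ∀ lam : Fin 3 → ℝ, (∀ i, 0 ≤ lam i) → ∑ i, lam i = 1 →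
          TenExp.frobNorm
              (X - TenExp.mixture lam (TenExp.tucker C H₁ H₂ H₃) (TenExp.fctn G₁ G₂ G₃)
                (TenExp.tf A B L)) ^ 2 ≤
            lam 0 * (TenExp.modeTail X 0 R₁ + TenExp.modeTail X 1 R₂ + TenExp.modeTail X 2 R₃)
            + lam 1 * (TenExp.modeTail X m₁₂ R₁₂ + TenExp.modeTail X m₁₃ R₁₃
                + TenExp.modeTail X m₂₃ R₂₃)
            + lam 2 * ((∑ n : Fin l,
                  TenExp.tail (TenExp.frontalSlice (TenExp.modeProd₃ X Lᵀ) n) R)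
                + TenExp.modeTail X 2 l) := by
  obtain ⟨C, H₁, H₂, H₃, o₁, o₂, o₃, e₁⟩ := TenExp.exists_tucker_error_le X hR₁ hR₂ hR₃
  obtain ⟨G₁, G₂, G₃, e₂⟩ :=
    TenExp.exists_fctn_error_le X hR₁₂ hR₁₃ hR₂₃ hm₁₂.1 hm₁₃.1 hm₂₃.1
  refine ⟨TenExp.exists_isLeadingLeftSingular _ hl, fun L hL => ?_⟩
  obtain ⟨A, B, e₃⟩ := TenExp.exists_tf_error_le X R hl hL
  refine ⟨C, H₁, H₂, H₃, G₁, G₂, G₃, A, B, o₁, o₂, o₃, fun lam h0 h1 => ?_⟩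
  rw [TenExp.frobNorm_sq]
  exact (TenExp.tensorSq_sub_mixture_le X _ _ _ h0 h1).trans
    (add_le_add (add_le_add (mul_le_mul_of_nonneg_left e₁ (h0 0))
      (mul_le_mul_of_nonneg_left e₂ (h0 1))) (mul_le_mul_of_nonneg_left e₃ (h0 2)))
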